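/- Let $l^2$ be the real or complex Hilbert space of square-summable sequences indexed by $\mathbb N$, with standard basis $(e_i)$, and let $T_{ij}=\langle Te_j,e_i\rangle$ denote the entries of the matrix of a bounded operator $T$ on $l^2$. Let $\mathcal S$ be a semigroup (under composition) of bounded operators on $l^2$ such that $T^*\in\mathcal S$ for every $T\in\mathcal S$, and such that every $T\in\mathcal S$ is positive in the sense of Banach lattices, i.e. maps sequences with nonnegative terms to sequences with nonnegative terms (equivalently, all entries $T_{ij}$ are nonnegative). Let $\mathcal S_+$ be the set of all positive semidefinite operators in $\mathcal S$. Suppose that either (i) every operator in $\mathcal S$ is trace class and the set $\{\operatorname{tr} T : T\in\mathcal S_+\}$ is finite, or (ii) for each $i\in\mathbb N$ the set $\{T_{ii} : T\in\mathcal S_+\}$ is finite. Then for every $S\in\mathcal S$ the operators $SS^*$ and $S^*S$ are projections (self-adjoint idempotents), and every nonzero entry $S_{ij}$ of $S$ has the form $S_{ij}=\sqrt{\xi\eta}$, where $\xi=(SS^*)_{ii}$ and $\eta=(S^*S)_{jj}$ are the diagonal entries of $SS^*$ and $S^*S$ in positions $i$ and $j$, respectively. -/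

import Mathlib

open scoped ComplexOrder

/-- The Hilbert space `l²` of square-summable sequences over `𝕜`, where `𝕜` is `ℝ` or `ℂ`. -/
abbrev SeqL2 (𝕜 : Type*) [RCLike 𝕜] : Type _ := lp (fun _ : ℕ => 𝕜) 2

namespace SeqL2

variable {𝕜 : Type*} [RCLike 𝕜]

/-- The entry `T i j = ⟨T e_j, e_i⟩` (row `i`, column `j`) of the matrix of `T` with respect to the
standard basis of `l²`. -/
noncomputable def entry (T : SeqL2 𝕜 →L[𝕜] SeqL2 𝕜) (i j : ℕ) : 𝕜 :=
  T (lp.single 2 j (1 : 𝕜)) i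

/-- `T` is a positive operator on the Banach lattice `l²`: it maps sequences with nonnegative (real)
terms to sequences with nonnegative (real) terms. In the order on `𝕜` that is used here, `0 ≤ z`
means that `z` is real and nonnegative. -/
def IsLatticePositive (T : SeqL2 𝕜 →L[𝕜] SeqL2 𝕜) : Prop :=
  ∀ x : SeqL2 𝕜, (∀ n, 0 ≤ x n) → ∀ n, 0 ≤ T x n

/-- `T` is trace class: its absolute value `|T|`, i.e. the positive semidefinite operator `A` with
`A² = T* T` (which always exists and is unique), has finite trace. -/
def IsTraceClass (T : SeqL2 𝕜 →L[𝕜] SeqL2 𝕜) : Prop :=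
  ∃ A : SeqL2 𝕜 →L[𝕜] SeqL2 𝕜, A.IsPositive ∧ A * A = star T * T ∧
    Summable fun i => entry A i i

/-- The trace of a trace class operator: the sum of its diagonal entries. -/
noncomputable def trace (T : SeqL2 𝕜 →L[𝕜] SeqL2 𝕜) : 𝕜 :=
  ∑' i, entry T i i

/-- The set of the positive semidefinite operators in a semigroup of operators. -/
def posSemidefPart (𝒮 : Subsemigroup (SeqL2 𝕜 →L[𝕜] SeqL2 𝕜)) :
    Set (SeqL2 𝕜 →L[𝕜] SeqL2 𝕜) :=
  {T | T ∈ 𝒮 ∧ T.IsPositive}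

end SeqL2

/-! For positive semidefinite `A` in the semigroup, the diagonal entries and traces of the powers of
`A` form convex sequences, with second differences given by `Aⁿ(1 - A)² ≥ 0`. A convex sequence with
finitely many values is eventually constant, so these differences vanish and `A² = A`
(`isStarProjection_of_mem_posSemidefPart`). This applies to `SS*` and `Q = S*S`.

As `Q` is a lattice positive projection, its range is closed under the modulus (`apply_modulus_eq`).
If `S i j ≠ 0`, this forces `r = S* e_i` and `q = Q e_j` to be proportional. Then `S i j = ⟨q, r⟩ =
‖q‖‖r‖`, where `‖r‖² = ξ` and `‖q‖² = η` (`exists_entry_eq_sqrt`). -/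

namespace ContinuousLinearMap

/-! ### Uniqueness of positive square roots -/

variable {𝕜 H : Type*} [RCLike 𝕜] [NormedAddCommGroup H] [InnerProductSpace 𝕜 H]

/-- A self-adjoint `Y` that anticommutes with an operator `X` dominating it is zero. -/
theorem eq_zero_of_anticommute {X Y : H →L[𝕜] H} (hX : X.IsSymmetric) (hY : Y.IsSymmetric)
    (hXY : X * Y + Y * X = 0)
    (hle : ∀ v, |RCLike.re (inner 𝕜 (Y v) v)| ≤ RCLike.re (inner 𝕜 (X v) v)) : Y = 0 := by
  -- With `t` the Rayleigh quotient of `Y` at `v` and `w = Yv - tv`, anticommutation leaves `Re⟨w,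
  -- Xv⟩ = -t Re⟨Xv, v⟩`. Domination and Cauchy–Schwarz then give `t⁴ ≤ ‖X‖²(‖Y‖² - t²)`; letting
  -- `|t|` tend to its supremum `‖Y‖` yields `‖Y‖⁴ ≤ 0`.
  have key : ∀ v : H, (|Y.rayleighQuotient v|) ^ 4 + ‖X‖ ^ 2 * |Y.rayleighQuotient v| ^ 2
      ≤ ‖X‖ ^ 2 * ‖Y‖ ^ 2 := by
    intro v
    by_cases hv : v = 0
    · subst hv; simp [rayleighQuotient, reApplyInnerSelf]; positivity
    set t := Y.rayleighQuotient v with ht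
    have hn : 0 < ‖v‖ ^ 2 := by positivity
    have h1 : RCLike.re (inner 𝕜 (Y v) v) = t * ‖v‖ ^ 2 := by
      rw [ht, rayleighQuotient, reApplyInnerSelf_apply]; field_simp
    set w := Y v - (t : 𝕜) • v with hw
    have h2 : ‖w‖ ^ 2 ≤ (‖Y‖ ^ 2 - t ^ 2) * ‖v‖ ^ 2 := by
      rw [hw, @norm_sub_sq 𝕜]
      simp only [inner_smul_right, RCLike.re_ofReal_mul, h1, norm_smul, RCLike.norm_ofReal]
      have : ‖Y v‖ ^ 2 ≤ (‖Y‖ * ‖v‖) ^ 2 := by gcongr; exact Y.le_opNorm v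
      rw [mul_pow, sq_abs]
      nlinarith
    have h3 : RCLike.re (inner 𝕜 (Y v) (X v)) = 0 := by
      have h := congrArg (fun Z : H →L[𝕜] H => RCLike.re (inner 𝕜 (Z v) v)) hXY
      simp only [add_apply, mul_apply_eq_comp, inner_add_left, map_add, zero_apply, inner_zero_left,
        map_zero] at h
      have ha : inner 𝕜 (X (Y v)) v = inner 𝕜 (Y v) (X v) := hX _ _
      have hb : inner 𝕜 (Y (X v)) v = inner 𝕜 (X v) (Y v) := hY _ _
      rw [ha, hb, inner_re_symm (X v)] at h
      linarith
    have h4 : RCLike.re (inner 𝕜 w (X v)) = - (t * RCLike.re (inner 𝕜 (X v) v)) := by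
      rw [hw, inner_sub_left, inner_smul_left, map_sub, h3, RCLike.conj_ofReal,
        RCLike.re_ofReal_mul, inner_re_symm v]
      ring
    have h5 : |t| * (|t| * ‖v‖ ^ 2) ≤ ‖w‖ * (‖X‖ * ‖v‖) := by
      calc |t| * (|t| * ‖v‖ ^ 2) ≤ |t| * RCLike.re (inner 𝕜 (X v) v) := by
            gcongr
            have := hle v
            rwa [h1, abs_mul, abs_of_pos hn] at this
        _ = |RCLike.re (inner 𝕜 w (X v))| := by
            rw [h4, abs_neg, abs_mul, abs_of_nonneg ((abs_nonneg _).trans (hle v))]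
        _ ≤ ‖w‖ * ‖X v‖ := (RCLike.abs_re_le_norm _).trans (norm_inner_le_norm _ _)
        _ ≤ _ := by gcongr; exact X.le_opNorm v
    have h6 : (|t| * (|t| * ‖v‖ ^ 2)) ^ 2 ≤ (‖w‖ * (‖X‖ * ‖v‖)) ^ 2 := by gcongr
    have h7 : (‖w‖ * (‖X‖ * ‖v‖)) ^ 2 ≤ (‖Y‖ ^ 2 - t ^ 2) * ‖v‖ ^ 2 * (‖X‖ * ‖v‖) ^ 2 := by
      rw [mul_pow]; gcongr
    have h8 : (|t| ^ 4 + ‖X‖ ^ 2 * |t| ^ 2) * (‖v‖ ^ 2) ^ 2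
        ≤ ‖X‖ ^ 2 * ‖Y‖ ^ 2 * (‖v‖ ^ 2) ^ 2 := by
      rw [sq_abs]; nlinarith
    exact le_of_mul_le_mul_right h8 (by positivity)
  have hcl : IsClosed {r : ℝ | r ^ 4 + ‖X‖ ^ 2 * r ^ 2 ≤ ‖X‖ ^ 2 * ‖Y‖ ^ 2} :=
    isClosed_le (by fun_prop) (by fun_prop)
  have hmem : ‖Y‖ ∈ {r : ℝ | r ^ 4 + ‖X‖ ^ 2 * r ^ 2 ≤ ‖X‖ ^ 2 * ‖Y‖ ^ 2} := by
    have := closure_minimal (Set.range_subset_iff.2 key) hcl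
      (csSup_mem_closure (Set.range_nonempty _) Y.bddAbove_rayleighQuotient)
    rwa [← iSup, ← norm_eq_iSup_rayleighQuotient Y hY] at this
  have h0 : ‖Y‖ ^ 4 ≤ 0 := by
    have : ‖Y‖ ^ 4 + ‖X‖ ^ 2 * ‖Y‖ ^ 2 ≤ ‖X‖ ^ 2 * ‖Y‖ ^ 2 := hmem
    linarith
  exact norm_eq_zero.1 (pow_eq_zero_iff (by norm_num) |>.1 (le_antisymm h0 (by positivity)))

/-- `B + C` dominates `B - C`, and their anticommutator is `2(B² - C²) = 0`. -/
theorem IsPositive.eq_of_mul_self_eq {B C : H →L[𝕜] H} (hB : B.IsPositive) (hC : C.IsPositive)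
    (h : B * B = C * C) : B = C := by
  refine sub_eq_zero.1 (eq_zero_of_anticommute (X := B + C) (Y := B - C)
    (hB.add hC).isSymmetric ?_ ?_ ?_)
  · exact hB.isSymmetric.sub hC.isSymmetric
  · have : (B + C) * (B - C) + (B - C) * (B + C) = 2 • (B * B - C * C) := by noncomm_ring
    rw [this, h, sub_self, smul_zero]
  · intro v
    have h1 := hB.re_inner_nonneg_left v
    have h2 := hC.re_inner_nonneg_left v
    simp only [sub_apply, add_apply, inner_sub_left, inner_add_left, map_sub, map_add]
    rw [abs_le]; constructor <;> linarith

/-! ### Powers of a positive operator and their second differences -/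

variable [CompleteSpace H]

theorem IsPositive.pow {A : H →L[𝕜] H} (hA : A.IsPositive) : ∀ n : ℕ, (A ^ n).IsPositive
  | 0 => by simp
  | 1 => by simpa using hA
  | n + 2 => by
    have h := (hA.pow n).conj_adjoint A
    have h' : A ^ (n + 2) = A ∘L (A ^ n) ∘L adjoint A := by
      rw [hA.isSelfAdjoint.adjoint_eq]
      change _ = A * (A ^ n * A)
      rw [← pow_succ, ← pow_succ']
    rwa [h']

theorem IsPositive.pow_mul_one_sub_sq {A : H →L[𝕜] H} (hA : A.IsPositive) (n : ℕ) :
    (A ^ n * (1 - A) ^ 2).IsPositive := by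
  have hs : adjoint (1 - A) = 1 - A := by
    rw [map_sub, hA.isSelfAdjoint.adjoint_eq]; congr 1; exact star_one _
  have h := (hA.pow n).conj_adjoint (1 - A)
  rw [hs] at h
  have hc : Commute (A ^ n) (1 - A) := ((Commute.one_right A).sub_right rfl).pow_left n
  have h' : A ^ n * (1 - A) ^ 2 = (1 - A) ∘L (A ^ n) ∘L (1 - A) := by
    change _ = (1 - A) * (A ^ n * (1 - A))
    rw [hc.eq, ← mul_assoc, ← sq, (hc.pow_right 2).eq]
  rwa [h']

/-- If `⟨Aⁿ(1 - A)² x, x⟩ = 0` for a positive operator `A` then `A² x = A x`. -/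
theorem IsPositive.apply_apply_eq_of_inner_pow_eq_zero {A : H →L[𝕜] H} (hA : A.IsPositive)
    {n : ℕ} {x : H} (h : RCLike.re (inner 𝕜 ((A ^ (2 * n) * (1 - A) ^ 2 : H →L[𝕜] H) x) x) = 0) :
    A (A x) = A x := by
  have hsym : ∀ m u v, inner 𝕜 ((A ^ m) u) v = inner 𝕜 u ((A ^ m) v) := fun m u v =>
    (hA.pow m).isSymmetric u v
  -- The even exponent makes the quadratic form equal to `‖Aⁿ(1 - A)x‖²`.
  have h1 : (A ^ n) ((1 - A) x) = 0 := by
    have hs : ∀ u v, inner 𝕜 ((1 - A) u) v = inner 𝕜 u ((1 - A) v) := fun u v =>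
      (isPositive_one.isSymmetric.sub hA.isSymmetric) u v
    have hc : Commute (A ^ n) (1 - A) := ((Commute.one_right A).sub_right rfl).pow_left n
    have e : A ^ (2 * n) * (1 - A) ^ 2 = (1 - A) * (A ^ n * (A ^ n * (1 - A))) := by
      rw [← mul_assoc (A ^ n), ← pow_add, ← two_mul, ← mul_assoc,
        ← (show Commute (A ^ (2 * n)) (1 - A) from
          ((Commute.one_right A).sub_right rfl).pow_left (2 * n)).eq, mul_assoc, sq]
    rw [e] at h
    simp only [mul_apply_eq_comp] at h
    rw [hs, hsym] at h
    rw [inner_self_eq_norm_sq] at h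
    exact norm_eq_zero.1 (pow_eq_zero_iff two_ne_zero |>.1 h)
  -- Self-adjointness: `‖Ay‖² = ⟨y, A²y⟩`, so the kernels of the powers do not grow.
  have h2 : ∀ m y, (A ^ m) y = 0 → A y = 0 := by
    intro m
    induction m with
    | zero => intro y hy; simp at hy; simp [hy]
    | succ m ih =>
      intro y hy
      have hy' : A (A y) = 0 := by
        apply ih; rwa [pow_succ, mul_apply_eq_comp] at hy
      have : inner 𝕜 (A y) (A y) = 0 := by
        rw [hA.isSymmetric.apply_clm, hy', inner_zero_right]
      exact inner_self_eq_zero.1 this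
  have h3 := h2 n _ h1
  rw [sub_apply, one_apply_eq_self, map_sub, sub_eq_zero] at h3
  exact h3.symm

end ContinuousLinearMap

/-- A convex real sequence with finitely many values has a vanishing second difference, arbitrarily
far out. -/
theorem exists_second_difference_eq_zero {a : ℕ → ℝ} (hconv : ∀ n, 2 * a (n + 1) ≤ a n + a (n + 2))
    (hfin : (Set.range a).Finite) : ∃ N, ∀ n ≥ N, a n - 2 * a (n + 1) + a (n + 2) = 0 := by
  obtain ⟨C, hC⟩ := hfin.bddAbove
  have hC : ∀ n, a n ≤ C := fun n => hC ⟨n, rfl⟩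
  have hmono : Monotone fun n => a (n + 1) - a n :=
    monotone_nat_of_le_succ fun n => by have := hconv n; linarith
  have hanti : Antitone a := by
    refine antitone_nat_of_succ_le fun n => ?_
    by_contra! hlt
    -- By convexity, a single increase would force at least linear growth, against boundedness.
    have hgrow : ∀ k : ℕ, a n + k * (a (n + 1) - a n) ≤ a (n + k) := by
      intro k
      induction k with
      | zero => simp
      | succ k ih =>
        have : a (n + 1) - a n ≤ a (n + k + 1) - a (n + k) := hmono (Nat.le_add_right n k)
        rw [← add_assoc]; push_cast; linarith
    obtain ⟨k, hk⟩ := exists_nat_gt ((C - a n) / (a (n + 1) - a n))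
    rw [div_lt_iff₀ (by linarith)] at hk
    linarith [hgrow k, hC (n + k)]
  obtain ⟨_, ⟨N, rfl⟩, hN⟩ := Set.exists_min_image _ id hfin (Set.range_nonempty a)
  have hconst : ∀ n ≥ N, a n = a N := fun n hn => le_antisymm (hanti hn) (hN _ ⟨n, rfl⟩)
  refine ⟨N, fun n hn => ?_⟩
  rw [hconst n hn, hconst (n + 1) (by omega), hconst (n + 2) (by omega)]; ring

theorem ContinuousLinearMap.re_inner_pow_mul_one_sub_sq {𝕜 H : Type*} [RCLike 𝕜]
    [NormedAddCommGroup H] [InnerProductSpace 𝕜 H] (A : H →L[𝕜] H) (n : ℕ) (x : H) :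
    RCLike.re (inner 𝕜 x ((A ^ n * (1 - A) ^ 2 : H →L[𝕜] H) x)) =
      RCLike.re (inner 𝕜 x ((A ^ n) x)) - 2 * RCLike.re (inner 𝕜 x ((A ^ (n + 1)) x)) +
        RCLike.re (inner 𝕜 x ((A ^ (n + 2)) x)) := by
  have e : A ^ n * (1 - A) ^ 2 = A ^ n - A ^ (n + 1) - A ^ (n + 1) + A ^ (n + 2) := by
    simp only [pow_succ, pow_zero, one_mul]; noncomm_ring
  rw [e]
  simp only [add_apply, sub_apply, inner_add_right, inner_sub_right, map_add, map_sub]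
  ring

/-! ### Positive semidefinite members are projections -/

namespace SeqL2

variable {𝕜 : Type*} [RCLike 𝕜]

theorem apply_eq_inner (x : SeqL2 𝕜) (i : ℕ) : x i = inner 𝕜 (lp.single 2 i (1 : 𝕜)) x := by
  rw [lp.inner_single_left]; simp

theorem entry_eq_inner (T : SeqL2 𝕜 →L[𝕜] SeqL2 𝕜) (i j : ℕ) :
    entry T i j = inner 𝕜 (lp.single 2 i (1 : 𝕜)) (T (lp.single 2 j (1 : 𝕜))) :=
  apply_eq_inner _ _

theorem mul_self_eq_of_forall_single {A : SeqL2 𝕜 →L[𝕜] SeqL2 𝕜} (hA : A.IsPositive)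
    (h : ∀ i, A (A (lp.single 2 i (1 : 𝕜))) = A (lp.single 2 i (1 : 𝕜))) : A * A = A := by
  ext x i
  rw [apply_eq_inner, apply_eq_inner (A x), mul_apply_eq_comp, ← hA.inner_left_eq_inner_right,
    ← hA.inner_left_eq_inner_right, h, hA.inner_left_eq_inner_right]

theorem mul_self_eq_of_second_difference {A : SeqL2 𝕜 →L[𝕜] SeqL2 𝕜} (hA : A.IsPositive)
    (h : ∀ i, ∃ N, ∀ n ≥ N, RCLike.re (entry (A ^ (n + 1) * (1 - A) ^ 2) i i) = 0) :
    A * A = A := by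
  refine mul_self_eq_of_forall_single hA fun i => ?_
  obtain ⟨N, hN⟩ := h i
  refine hA.apply_apply_eq_of_inner_pow_eq_zero (n := N + 1) ?_
  -- This index makes the exponent `2(N + 1)` even.
  have := hN (2 * N + 1) (by omega)
  rwa [entry_eq_inner, inner_re_symm, show 2 * N + 1 + 1 = 2 * (N + 1) by ring] at this

theorem re_entry_pow_mul_one_sub_sq (A : SeqL2 𝕜 →L[𝕜] SeqL2 𝕜) (n i : ℕ) :
    RCLike.re (entry (A ^ n * (1 - A) ^ 2) i i) =
      RCLike.re (entry (A ^ n) i i) - 2 * RCLike.re (entry (A ^ (n + 1)) i i) +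
        RCLike.re (entry (A ^ (n + 2)) i i) := by
  simp only [entry_eq_inner, A.re_inner_pow_mul_one_sub_sq]

theorem re_entry_pow_mul_one_sub_sq_nonneg {A : SeqL2 𝕜 →L[𝕜] SeqL2 𝕜} (hA : A.IsPositive)
    (n i : ℕ) : 0 ≤ RCLike.re (entry (A ^ n * (1 - A) ^ 2) i i) := by
  rw [entry_eq_inner]
  exact (hA.pow_mul_one_sub_sq n).re_inner_nonneg_right _

/-- A positive operator whose powers have finitely many diagonal entries at each position is
idempotent. -/
theorem mul_self_eq_of_finite_diagonal {A : SeqL2 𝕜 →L[𝕜] SeqL2 𝕜} (hA : A.IsPositive)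
    (h : ∀ i, (Set.range fun n : ℕ => entry (A ^ (n + 1)) i i).Finite) : A * A = A := by
  refine mul_self_eq_of_second_difference hA fun i => ?_
  have hd := fun n => re_entry_pow_mul_one_sub_sq A (n + 1) i
  obtain ⟨N, hN⟩ := exists_second_difference_eq_zero
    (a := fun n => RCLike.re (entry (A ^ (n + 1)) i i))
    (fun n => by
      have h1 := re_entry_pow_mul_one_sub_sq_nonneg hA (n + 1) i
      rw [hd] at h1
      linarith)
    (by rw [Set.range_comp' RCLike.re]; exact (h i).image _)
  exact ⟨N, fun n hn => (hd n).trans (hN n hn)⟩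

/-- A positive operator whose powers are summable on the diagonal, with finitely many traces, is
idempotent. -/
theorem mul_self_eq_of_finite_trace {A : SeqL2 𝕜 →L[𝕜] SeqL2 𝕜} (hA : A.IsPositive)
    (hs : ∀ n : ℕ, Summable fun i => entry (A ^ (n + 1)) i i)
    (h : (Set.range fun n : ℕ => trace (A ^ (n + 1))).Finite) : A * A = A := by
  have ht : ∀ n : ℕ, HasSum (fun i => RCLike.re (entry (A ^ (n + 1)) i i))
      (RCLike.re (trace (A ^ (n + 1)))) := fun n => RCLike.hasSum_re 𝕜 (hs n).hasSum
  have hd : ∀ n : ℕ, HasSum (fun i => RCLike.re (entry (A ^ (n + 1) * (1 - A) ^ 2) i i))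
      (RCLike.re (trace (A ^ (n + 1))) - 2 * RCLike.re (trace (A ^ (n + 1 + 1))) +
        RCLike.re (trace (A ^ (n + 2 + 1)))) := fun n => by
    simp only [re_entry_pow_mul_one_sub_sq]
    exact ((ht n).sub ((ht (n + 1)).mul_left 2)).add (ht (n + 2))
  have hnn := fun n i => re_entry_pow_mul_one_sub_sq_nonneg hA (n + 1) i
  obtain ⟨N, hN⟩ := exists_second_difference_eq_zero
    (a := fun n => RCLike.re (trace (A ^ (n + 1))))
    (fun n => by linarith [(hd n).nonneg (hnn n)])
    (by rw [Set.range_comp' RCLike.re]; exact h.image _)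
  refine mul_self_eq_of_second_difference hA fun i => ⟨N, fun n hn => ?_⟩
  have h0 := hd n
  rw [hN n hn, hasSum_zero_iff_of_nonneg (hnn n)] at h0
  exact congrFun h0 i

/-- Uniqueness of the positive square root identifies `|A|` with `A`. -/
theorem IsTraceClass.summable_entry {A : SeqL2 𝕜 →L[𝕜] SeqL2 𝕜} (h : IsTraceClass A)
    (hA : A.IsPositive) : Summable fun i => entry A i i := by
  obtain ⟨B, hB, hBA, hs⟩ := h
  rw [hA.isSelfAdjoint.star_eq] at hBA
  rwa [← hB.eq_of_mul_self_eq hA hBA]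

theorem isStarProjection_of_mem_posSemidefPart {𝒮 : Subsemigroup (SeqL2 𝕜 →L[𝕜] SeqL2 𝕜)}
    (hfin : ((∀ T ∈ 𝒮, IsTraceClass T) ∧ (trace '' posSemidefPart 𝒮).Finite) ∨
        (∀ i : ℕ, ((fun T => entry T i i) '' posSemidefPart 𝒮).Finite))
    {A : SeqL2 𝕜 →L[𝕜] SeqL2 𝕜} (hA : A ∈ posSemidefPart 𝒮) : IsStarProjection A := by
  -- Exponents start at 1 because the semigroup need not contain the identity.
  have hpow : ∀ n : ℕ, A ^ (n + 1) ∈ posSemidefPart 𝒮 := fun n => by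
    refine ⟨?_, hA.2.pow _⟩
    induction n with
    | zero => simpa using hA.1
    | succ n ih => rw [pow_succ]; exact 𝒮.mul_mem ih hA.1
  refine ⟨?_, hA.2.isSelfAdjoint⟩
  rcases hfin with ⟨htc, hf⟩ | hf
  · refine mul_self_eq_of_finite_trace hA.2
      (fun n => (htc _ (hpow n).1).summable_entry (hpow n).2) (hf.subset ?_)
    rintro _ ⟨n, rfl⟩
    exact ⟨_, hpow n, rfl⟩
  · refine mul_self_eq_of_finite_diagonal hA.2 fun i => (hf i).subset ?_
    rintro _ ⟨n, rfl⟩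
    exact ⟨_, hpow n, rfl⟩

end SeqL2

/-! ### Lattice structure and the form of the entries -/

namespace SeqL2

variable {𝕜 : Type*} [RCLike 𝕜]

/-- The modulus of a sequence, taken term by term. -/
noncomputable def modulus (x : SeqL2 𝕜) : SeqL2 𝕜 :=
  ⟨fun n => (‖x n‖ : 𝕜), memℓp_gen <| by
    simpa only [RCLike.norm_ofReal, abs_norm] using (lp.memℓp x).summable (by norm_num)⟩

@[simp] theorem modulus_apply (x : SeqL2 𝕜) (n : ℕ) : modulus x n = (‖x n‖ : 𝕜) := rfl

theorem modulus_nonneg (x : SeqL2 𝕜) (n : ℕ) : 0 ≤ modulus x n := by simp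

theorem modulus_of_nonneg {x : SeqL2 𝕜} (hx : ∀ n, 0 ≤ x n) : modulus x = x := by
  ext n
  exact RCLike.norm_of_nonneg' (hx n)

theorem hasSum_norm_mul_norm (x y : SeqL2 𝕜) :
    HasSum (fun n => ‖x n‖ * ‖y n‖) (RCLike.re (inner 𝕜 (modulus x) (modulus y))) := by
  have h := RCLike.hasSum_re 𝕜 (lp.hasSum_inner (𝕜 := 𝕜) (modulus x) (modulus y))
  refine h.congr_fun fun n => ?_
  simp [mul_comm]

theorem norm_inner_le_re_inner_modulus (x y : SeqL2 𝕜) :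
    ‖inner 𝕜 x y‖ ≤ RCLike.re (inner 𝕜 (modulus x) (modulus y)) := by
  rw [lp.inner_eq_tsum]
  refine tsum_of_norm_bounded (hasSum_norm_mul_norm x y) fun n => ?_
  exact norm_inner_le_norm _ _

theorem eq_zero_or_eq_zero_of_inner_eq_zero {x y : SeqL2 𝕜} (hx : ∀ n, 0 ≤ x n)
    (hy : ∀ n, 0 ≤ y n) (h : inner 𝕜 x y = 0) (n : ℕ) : x n = 0 ∨ y n = 0 := by
  have hs := hasSum_norm_mul_norm x y
  rw [modulus_of_nonneg hx, modulus_of_nonneg hy, h, map_zero,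
    hasSum_zero_iff_of_nonneg fun n => by positivity] at hs
  simpa using congrFun hs n

theorem single_nonneg (i n : ℕ) : 0 ≤ (lp.single 2 i (1 : 𝕜) : SeqL2 𝕜) n := by
  rw [lp.single_apply, Pi.single_apply]
  split_ifs <;> simp

theorem star_apply_eq_inner (T : SeqL2 𝕜 →L[𝕜] SeqL2 𝕜) (x : SeqL2 𝕜) (i : ℕ) :
    T x i = inner 𝕜 (star T (lp.single 2 i (1 : 𝕜))) x := by
  rw [apply_eq_inner, ContinuousLinearMap.star_eq_adjoint, ContinuousLinearMap.adjoint_inner_left]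

theorem IsLatticePositive.norm_apply_le {T : SeqL2 𝕜 →L[𝕜] SeqL2 𝕜}
    (hT : IsLatticePositive (star T)) (x : SeqL2 𝕜) (i : ℕ) : ‖T x i‖ ≤ ‖T (modulus x) i‖ := by
  rw [star_apply_eq_inner, star_apply_eq_inner T]
  refine (norm_inner_le_re_inner_modulus _ _).trans ?_
  rw [modulus_of_nonneg (hT _ (single_nonneg i))]
  exact RCLike.re_le_norm _

/-- The range of a lattice positive projection is closed under the modulus. -/
theorem IsLatticePositive.apply_modulus_eq {Q : SeqL2 𝕜 →L[𝕜] SeqL2 𝕜} (hQ : IsLatticePositive Q)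
    (hproj : IsStarProjection Q) {x : SeqL2 𝕜} (hx : Q x = x) : Q (modulus x) = modulus x := by
  set w := modulus x with hw
  have hsym : Q.IsPositive := .of_isStarProjection hproj
  -- Termwise `|x| = |Qx| ≤ Q|x|`; pairing with `|x|` gives the bound, and `⟨Qw, w⟩ = ‖Qw‖²` then
  -- makes `‖Qw - w‖²` nonpositive.
  have h1 : ‖w‖ ^ 2 ≤ RCLike.re (inner 𝕜 (Q w) w) := by
    rw [← inner_self_eq_norm_sq (𝕜 := 𝕜) w, ← modulus_of_nonneg (hQ w (modulus_nonneg x)), hw]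
    refine hasSum_le (fun n => ?_) (hasSum_norm_mul_norm x x) (hasSum_norm_mul_norm _ x)
    gcongr
    have := norm_apply_le (T := Q) (by rwa [hproj.isSelfAdjoint.star_eq]) x n
    rwa [hx] at this
  have h2 : ‖Q w‖ ^ 2 = RCLike.re (inner 𝕜 (Q w) w) := by
    rw [← inner_self_eq_norm_sq (𝕜 := 𝕜) (Q w), ← hsym.inner_left_eq_inner_right,
      ← mul_apply_eq_comp, hproj.isIdempotentElem.eq]
  have h3 : ‖Q w - w‖ ^ 2 ≤ 0 := by
    rw [@norm_sub_sq 𝕜, h2]; linarith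
  exact sub_eq_zero.1 (norm_eq_zero.1 (pow_eq_zero_iff two_ne_zero |>.1
    (le_antisymm h3 (by positivity))))

/-- With `Q = S*S`, `(SQ - S)*(SQ - S) = (Q - 1)(Q² - Q) = 0`. -/
theorem mul_star_mul_self_eq {S : SeqL2 𝕜 →L[𝕜] SeqL2 𝕜} (h : IsStarProjection (star S * S)) :
    S * (star S * S) = S := by
  rw [← sub_eq_zero, ← CStarRing.star_mul_self_eq_zero_iff]
  have e := h.isIdempotentElem.eq
  simp only [star_sub, star_mul, star_star]
  have : (star S * S - 1) * (star S * S * (star S * S) - star S * S) =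
    (star S * S * star S - star S) * (S * (star S * S) - S) := by noncomm_ring
  rw [← this, e, sub_self, mul_zero]

theorem exists_entry_eq_sqrt {S : SeqL2 𝕜 →L[𝕜] SeqL2 𝕜} (hS : IsLatticePositive S)
    (hS' : IsLatticePositive (star S)) (hQ : IsStarProjection (star S * S)) {i j : ℕ}
    (hij : entry S i j ≠ 0) : ∃ ξ η : ℝ, entry (S * star S) i i = (ξ : 𝕜) ∧
      entry (star S * S) j j = (η : 𝕜) ∧ entry S i j = (Real.sqrt (ξ * η) : 𝕜) := by
  set s := entry S i j with hs
  set Q := star S * S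
  set r := star S (lp.single 2 i (1 : 𝕜)) with hr
  set q := Q (lp.single 2 j (1 : 𝕜)) with hq
  have hQlat : IsLatticePositive Q := fun x hx => hS' _ (hS x hx)
  have hQsym : Q.IsPositive := .of_isStarProjection hQ
  have hSQ : S * Q = S := mul_star_mul_self_eq hQ
  have hQS : Q * star S = star S := by
    have := congrArg star hSQ
    rwa [star_mul, hQ.isSelfAdjoint.star_eq] at this
  have hQQ : ∀ x, Q (Q x) = Q x := fun x => by
    rw [← mul_apply_eq_comp, hQ.isIdempotentElem.eq]
  have hQr : Q r = r := by rw [hr, ← mul_apply_eq_comp, hQS]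
  have hSr : ∀ x, (S x) i = inner 𝕜 r x := fun x => star_apply_eq_inner S x i
  have hr0 : ∀ n, 0 ≤ r n := hS' _ (single_nonneg i)
  have hs0 : 0 ≤ s := hS _ (single_nonneg j) i
  have hqr : inner 𝕜 q r = s := by
    have h : s = inner 𝕜 r q := by
      rw [← hSr, hq, ← mul_apply_eq_comp, hSQ]; rfl
    rw [← inner_conj_symm, ← h]
    exact RCLike.conj_eq_iff_im.2 (RCLike.nonneg_iff.1 hs0).2
  have hqn : (‖q‖ : 𝕜) ^ 2 ≠ 0 := by
    intro h
    -- Otherwise `⟨q, r⟩ = S i j` would vanish.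
    have : q = 0 := by simpa using h
    rw [this, inner_zero_left] at hqr
    exact hij hqr.symm
  set c : 𝕜 := s / (‖q‖ : 𝕜) ^ 2 with hc
  set y := r - c • q with hy
  have hQy : Q y = y := by rw [hy, map_sub, map_smul, hQr, hq, hQQ]
  have hqx : ∀ x, Q x = x → inner 𝕜 q x = x j := fun x hx => by
    rw [hq, hQsym.inner_left_eq_inner_right, hx, apply_eq_inner]
  -- `c` is the projection coefficient of `r` on `q`; the aim is to show that the remainder `y` is
  -- zero.
  have hqy : inner 𝕜 q y = 0 := by
    rw [hy, inner_sub_right, inner_smul_right, hqr, inner_self_eq_norm_sq_to_K, hc,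
      div_mul_cancel₀ _ hqn, sub_self]
  have hw0 : ∀ n, 0 ≤ modulus y n := modulus_nonneg y
  have hQw : Q (modulus y) = modulus y := hQlat.apply_modulus_eq hQ hQy
  -- On the range of `Q`, pairing with `q` reads off coordinate `j`, and `y j = 0` gives `|y| j =
  -- 0`.
  have hqw : inner 𝕜 q (modulus y) = 0 := by
    rw [hqx _ hQw, modulus_apply, ← hqx y hQy, hqy]; simp
  have hSw : inner 𝕜 (S (lp.single 2 j (1 : 𝕜))) (S (modulus y)) = 0 := by
    rw [← ContinuousLinearMap.adjoint_inner_left, ← ContinuousLinearMap.star_eq_adjoint,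
      ← mul_apply_eq_comp]
    exact hqw
  -- `S e_j` and `S|y|` are nonnegative and orthogonal, hence disjointly supported, and `S e_j` is
  -- nonzero at `i`.
  have hrw : inner 𝕜 r (modulus y) = 0 := by
    rw [← hSr]
    exact (eq_zero_or_eq_zero_of_inner_eq_zero (hS _ (single_nonneg j)) (hS _ hw0) hSw
      i).resolve_left hij
  have hry : inner 𝕜 r y = 0 := by
    have := norm_inner_le_re_inner_modulus r y
    rw [modulus_of_nonneg hr0, hrw, map_zero] at this
    exact norm_le_zero_iff.1 this
  have hy0 : y = 0 := by
    have : inner 𝕜 (r - c • q) y = 0 := by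
      rw [inner_sub_left, inner_smul_left, hry, hqy, mul_zero, sub_zero]
    exact inner_self_eq_zero.1 this
  have hrn : ‖r‖ = ‖c‖ * ‖q‖ := by rw [← norm_smul, ← sub_eq_zero.1 hy0]
  have hsn : ‖s‖ = ‖c‖ * ‖q‖ ^ 2 := by
    have : s = c * (‖q‖ : 𝕜) ^ 2 := (div_mul_cancel₀ _ hqn).symm
    rw [this, norm_mul, norm_pow, RCLike.norm_ofReal, abs_norm]
  refine ⟨‖r‖ ^ 2, ‖q‖ ^ 2, ?_, ?_, ?_⟩
  · push_cast
    rw [← inner_self_eq_norm_sq_to_K, ← hSr]; rfl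
  · push_cast
    rw [← inner_self_eq_norm_sq_to_K, hqx q (hQQ _)]; rfl
  · rw [← mul_pow, Real.sqrt_sq (by positivity), ← RCLike.norm_of_nonneg' hs0, hsn, hrn]
    congr 1; ring

end SeqL2

theorem mainTheorem3 {𝕜 : Type*} [RCLike 𝕜]
    (𝒮 : Subsemigroup (SeqL2 𝕜 →L[𝕜] SeqL2 𝕜))
    (hself : ∀ T ∈ 𝒮, star T ∈ 𝒮)
    (hpos : ∀ T ∈ 𝒮, SeqL2.IsLatticePositive T)
    (hfin : ((∀ T ∈ 𝒮, SeqL2.IsTraceClass T) ∧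
          (SeqL2.trace '' SeqL2.posSemidefPart 𝒮).Finite) ∨
        (∀ i : ℕ, ((fun T => SeqL2.entry T i i) '' SeqL2.posSemidefPart 𝒮).Finite)) :
    ∀ S ∈ 𝒮, IsStarProjection (S * star S) ∧ IsStarProjection (star S * S) ∧
      ∀ i j : ℕ, SeqL2.entry S i j ≠ 0 →
        ∃ ξ η : ℝ, SeqL2.entry (S * star S) i i = (ξ : 𝕜) ∧
          SeqL2.entry (star S * S) j j = (η : 𝕜) ∧
          SeqL2.entry S i j = (Real.sqrt (ξ * η) : 𝕜) := by
  intro S hS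
  have hS' := hself S hS
  have hQ : IsStarProjection (star S * S) := SeqL2.isStarProjection_of_mem_posSemidefPart hfin
    ⟨𝒮.mul_mem hS' hS, ContinuousLinearMap.isPositive_adjoint_comp_self S⟩
  exact ⟨SeqL2.isStarProjection_of_mem_posSemidefPart hfin
    ⟨𝒮.mul_mem hS hS', ContinuousLinearMap.isPositive_self_comp_adjoint S⟩, hQ,
    fun i j => SeqL2.exists_entry_eq_sqrt (hpos S hS) (hpos _ hS') hQ⟩
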